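/- Let $X$ be a metric space of bounded geometry, i.e. $\sup_{x\in X}\sharp B(x,R)<\infty$ for every $R\ge 0$, where $B(x,R)$ is the closed ball, let $E$ be a complex Banach space, and let $p\in\{0\}\cup[1,\infty]$. Write $\ell^p_E(X)=\ell^p(X;E)$ for $p\in[1,\infty]$ and $\ell^0_E(X)=c_0(X;E)$ (with the supremum norm), and let $C_b(X)$ act on $\ell^p_E(X)$ by pointwise multiplication. An operator $a\in\mathfrak B(\ell^p_E(X))$ has finite propagation if there is $R\ge 0$ such that $faf'=0$ for all $f,f'\in C_b(X)$ with $d(\mathrm{supp} f,\mathrm{supp} f')>R$. Let the band-dominated operator algebra $\mathcal A^p_E(X)$ be the operator-norm closure in $\mathfrak B(\ell^p_E(X))$ of the algebra of operators of finite propagation, and let $B^p_u(X)=\mathcal A^p_{\mathbb C}(X)\subseteq\mathfrak B(\ell^p(X))$ be the $\ell^p$ uniform Roe algebra. If $p\in(1,\infty)$, assume in addition that $X$ has Property A: for some $q\in[1,\infty)$ and all $r,\varepsilon>0$ there is a family of functions $\phi_i:X\to[0,1]$ $(i\in I)$, whose supports have uniformly bounded diameters and finite multiplicity (there is $M$ such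 that each point of $X$ lies in at most $M$ of them), such that $\sum_{i}\phi_i(x)^q=1$ for all $x\in X$ and $\sum_{i}|\phi_i(x)-\phi_i(y)|^q<\varepsilon^q$ whenever $d(x,y)\le r$. Then $B^p_u(X)$ is closed under taking inverses in $\mathfrak B(\ell^p(X))$, and $\mathcal A^p_E(X)$ is closed under taking inverses in $\mathfrak B(\ell^p_E(X))$: if $a$ lies in the algebra and is invertible in the ambient algebra of bounded operators, then $a^{-1}$ lies in the algebra. -/

import Mathlib

open scoped ENNReal NNReal BoundedContinuousFunction ZeroAtInfty

universe u v

noncomputable section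

/-! ### Metric geometry -/

/-- A metric space has bounded geometry if, for every radius, the cardinalities of closed balls
of this radius are bounded uniformly in the centre. -/
def BoundedGeometry (X : Type u) [MetricSpace X] : Prop :=
  ∀ R : ℝ, ∃ N : ℕ, ∀ x : X, (Metric.closedBall x R).encard ≤ N

/-- A metric `q`-partition of unity: functions `φ i : X → [0,1]` whose supports are uniformly
bounded and of finite multiplicity, and such that `∑ i, φ i x ^ q = 1` for every `x`. -/
structure IsMetricPartitionOfUnity {X : Type u} [MetricSpace X] (q : ℝ) {ι : Type u}
    (φ : ι → X → ℝ) : Prop where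
  mem_Icc : ∀ i x, φ i x ∈ Set.Icc (0 : ℝ) 1
  uniformly_bounded : ∃ S : ℝ, ∀ i, ∀ x ∈ tsupport (φ i), ∀ y ∈ tsupport (φ i), dist x y ≤ S
  finite_multiplicity : ∃ M : ℕ, ∀ x, {i | x ∈ tsupport (φ i)}.encard ≤ M
  hasSum_one : ∀ x, HasSum (fun i => φ i x ^ q) 1

/-- `(r, ε)`-variation of a metric `q`-partition of unity (the sums have only finitely many nonzero
terms, because of finite multiplicity). -/
def HasVariation {X : Type u} [MetricSpace X] (q : ℝ) {ι : Type u} (φ : ι → X → ℝ)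
    (r ε : ℝ) : Prop :=
  ∀ x y : X, dist x y ≤ r → ∑' i, |φ i x - φ i y| ^ q < ε ^ q

/-- Property A: for some exponent `q ∈ [1,∞)` there are metric `q`-partitions of unity with
arbitrarily small variation. (On spaces of bounded geometry this does not depend on `q`; asking for
some `q` makes this the weakest version.) -/
def PropertyA (X : Type u) [MetricSpace X] : Prop :=
  ∃ q : ℝ, 1 ≤ q ∧ ∀ r > 0, ∀ ε > 0, ∃ (ι : Type u) (φ : ι → X → ℝ),
    IsMetricPartitionOfUnity q φ ∧ HasVariation q φ r ε

/-- The distance `d(A, B) = inf {d(x,y) | x ∈ A, y ∈ B}` of two subsets (`∞` if one is empty). -/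
def setEDist {X : Type u} [MetricSpace X] (A B : Set X) : ℝ≥0∞ :=
  ⨅ x ∈ A, ⨅ y ∈ B, edist x y

/-! ### Finite propagation and Roe algebras, relative to a representation of `C_b(X)` -/

section Propagation

variable {X : Type u} [MetricSpace X] {V : Type v} [NormedAddCommGroup V] [NormedSpace ℂ V]

/-- With respect to a representation `ρ` of `C_b(X)` on `V`, an operator `a` has propagation at most
`R` if `f a f' = 0` whenever `f, f' ∈ C_b(X)` satisfy `d(supp f, supp f') > R`. -/
def HasPropagationLE (ρ : (X →ᵇ ℂ) →ₐ[ℂ] (V →L[ℂ] V)) (R : ℝ≥0) (a : V →L[ℂ] V) : Prop :=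
  ∀ f f' : X →ᵇ ℂ, (R : ℝ≥0∞) < setEDist (tsupport f) (tsupport f') → ρ f * a * ρ f' = 0

theorem HasPropagationLE.mono {ρ : (X →ᵇ ℂ) →ₐ[ℂ] (V →L[ℂ] V)} {R S : ℝ≥0} {a : V →L[ℂ] V}
    (h : HasPropagationLE ρ R a) (hRS : R ≤ S) : HasPropagationLE ρ S a := fun f f' hf =>
  h f f' (lt_of_le_of_lt (by exact_mod_cast hRS) hf)

theorem lt_setEDist {A B : Set X} {R S : ℝ} (hR : 0 ≤ R) (hRS : R < S)
    (h : ∀ x ∈ A, ∀ y ∈ B, S ≤ dist x y) : (R.toNNReal : ℝ≥0∞) < setEDist A B := by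
  have h1 : (R.toNNReal : ℝ≥0∞) < ENNReal.ofReal S :=
    (ENNReal.ofReal_lt_ofReal_iff (hR.trans_lt hRS)).2 hRS
  refine h1.trans_le ?_
  refine le_iInf₂ fun x hx => le_iInf₂ fun y hy => ?_
  rw [edist_dist]
  exact ENNReal.ofReal_le_ofReal (h x hx y hy)

theorem le_dist_of_lt_setEDist {A B : Set X} {R : ℝ} {x y : X}
    (h : (R.toNNReal : ℝ≥0∞) < setEDist A B) (hx : x ∈ A) (hy : y ∈ B) : R ≤ dist x y := by
  have h1 : setEDist A B ≤ edist x y := iInf₂_le_of_le x hx (iInf₂_le y hy)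
  have h2 := (h.trans_le h1).le
  rw [edist_dist] at h2
  exact (ENNReal.ofReal_le_ofReal_iff dist_nonneg).1 h2

/-- A continuous cutoff around a set `A`. -/
def cutoff (A : Set X) (R : ℝ) : X →ᵇ ℂ :=
  BoundedContinuousFunction.ofNormedAddCommGroup
    (fun x => ((max 0 (min 1 (R - Metric.infDist x A)) : ℝ) : ℂ))
    (by
      have := Metric.continuous_infDist_pt A
      fun_prop) 1
    (fun x => by
      rw [Complex.norm_real, Real.norm_of_nonneg (le_max_left _ _)]
      exact max_le zero_le_one (min_le_left _ _))

theorem cutoff_apply (A : Set X) (R : ℝ) (x : X) :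
    cutoff A R x = ((max 0 (min 1 (R - Metric.infDist x A)) : ℝ) : ℂ) := rfl

theorem infDist_le_of_mem_tsupport_cutoff {A : Set X} {R : ℝ} {x : X}
    (hx : x ∈ tsupport (cutoff A R)) : Metric.infDist x A ≤ R := by
  refine closure_minimal (t := {x | Metric.infDist x A ≤ R}) ?_
    (isClosed_le (Metric.continuous_infDist_pt A) continuous_const) hx
  intro z hz
  by_contra hlt
  simp only [Set.mem_ofPred_eq, not_le] at hlt
  apply hz
  have hmin : min (1 : ℝ) (R - Metric.infDist z A) ≤ 0 := (min_le_right _ _).trans (by linarith)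
  rw [cutoff_apply, max_eq_left hmin, Complex.ofReal_zero]

theorem le_infDist_of_mem_tsupport_one_sub_cutoff {A : Set X} {R : ℝ} {x : X}
    (hx : x ∈ tsupport (1 - cutoff A R : X →ᵇ ℂ)) : R - 1 ≤ Metric.infDist x A := by
  refine closure_minimal (t := {x | R - 1 ≤ Metric.infDist x A}) ?_
    (isClosed_le continuous_const (Metric.continuous_infDist_pt A)) hx
  intro z hz
  by_contra hlt
  simp only [Set.mem_ofPred_eq, not_le] at hlt
  apply hz
  have hmin : min (1 : ℝ) (R - Metric.infDist z A) = 1 := min_eq_left (by linarith)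
  simp [cutoff_apply, hmin]

theorem HasPropagationLE.mul {ρ : (X →ᵇ ℂ) →ₐ[ℂ] (V →L[ℂ] V)} {R S : ℝ≥0} {a b : V →L[ℂ] V}
    (ha : HasPropagationLE ρ R a) (hb : HasPropagationLE ρ S b) :
    HasPropagationLE ρ (R + S + 3) (a * b) := by
  intro f f' hff'
  rcases (tsupport f).eq_empty_or_nonempty with hemp | hne
  · have : f = 0 := by
      ext x
      exact congrFun (tsupport_eq_empty_iff.1 hemp) x
    simp [this]
  have hR : (0 : ℝ) ≤ R := R.2
  have hS : (0 : ℝ) ≤ S := S.2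
  set g : X →ᵇ ℂ := cutoff (tsupport f) (R + 2) with hg
  have h1 : ρ f * a * ρ (1 - g) = 0 := by
    apply ha
    have := lt_setEDist (A := tsupport f) (B := tsupport (1 - g : X →ᵇ ℂ)) (R := R) (S := R + 1)
      hR (by linarith) (fun x hx y hy => by
        have h2 := le_infDist_of_mem_tsupport_one_sub_cutoff hy
        have h3 := Metric.infDist_le_dist_of_mem (x := y) hx
        rw [dist_comm] at h3
        linarith)
    simpa using this
  have h2 : ρ g * b * ρ f' = 0 := by
    apply hb
    have := lt_setEDist (A := tsupport g) (B := tsupport f') (R := S) (S := S + 1 / 2)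
      hS (by linarith) (fun x hx y hy => by
        have h2 := infDist_le_of_mem_tsupport_cutoff hx
        obtain ⟨z, hz, hxz⟩ := (Metric.infDist_lt_iff (r := R + 2 + 1 / 2) hne).1
          (lt_of_le_of_lt h2 (by linarith))
        have h4 : (((R : ℝ) + S + 3).toNNReal : ℝ≥0∞) < setEDist (tsupport f) (tsupport f') := by
          have h5 : ((R : ℝ) + S + 3).toNNReal = R + S + 3 := by
            ext
            rw [Real.coe_toNNReal _ (by positivity)]
            push_cast
            rfl
          rw [h5]
          exact hff'
        have h5 := le_dist_of_lt_setEDist h4 hz hy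
        have h6 := dist_triangle_left z y x
        linarith)
    simpa using this
  calc ρ f * (a * b) * ρ f' = ρ f * a * ρ (g + (1 - g)) * b * ρ f' := by
        rw [add_sub_cancel, map_one, mul_one, mul_assoc (ρ f) a b]
    _ = ρ f * a * (ρ g * b * ρ f') + (ρ f * a * ρ (1 - g)) * b * ρ f' := by
        rw [map_add]
        noncomm_ring
    _ = 0 := by rw [h1, h2]; simp

theorem hasPropagationLE_algebraMap (ρ : (X →ᵇ ℂ) →ₐ[ℂ] (V →L[ℂ] V)) (c : ℂ) :
    HasPropagationLE ρ 0 (algebraMap ℂ (V →L[ℂ] V) c) := by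
  intro f f' h
  have hff' : f * f' = 0 := by
    ext x
    by_contra hne
    have hx : f x ≠ 0 ∧ f' x ≠ 0 := by simpa using hne
    have h1 : setEDist (tsupport f) (tsupport f') ≤ edist x x :=
      iInf₂_le_of_le x (subset_tsupport _ hx.1) (iInf₂_le x (subset_tsupport _ hx.2))
    rw [edist_self] at h1
    exact absurd (h.trans_le h1) (by simp)
  rw [← Algebra.commutes, mul_assoc, ← map_mul, hff', map_zero, mul_zero]

/-- The algebra of operators of finite propagation. -/
def finitePropagation (ρ : (X →ᵇ ℂ) →ₐ[ℂ] (V →L[ℂ] V)) : Subalgebra ℂ (V →L[ℂ] V) where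
  carrier := {a | ∃ R : ℝ≥0, HasPropagationLE ρ R a}
  mul_mem' := fun ⟨R, ha⟩ ⟨S, hb⟩ => ⟨R + S + 3, ha.mul hb⟩
  add_mem' := fun {a b} ⟨R, ha⟩ ⟨S, hb⟩ => ⟨max R S, fun f f' h => by
    rw [mul_add, add_mul, ha.mono (le_max_left R S) f f' h, hb.mono (le_max_right R S) f f' h,
      add_zero]⟩
  algebraMap_mem' := fun c => ⟨0, hasPropagationLE_algebraMap ρ c⟩

/-- The Roe-like algebra `Roe(X, 𝔅(V))`: the operator-norm closure in `𝔅(V)` of the algebra of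
operators of finite propagation. -/
def roeAlgebra (ρ : (X →ᵇ ℂ) →ₐ[ℂ] (V →L[ℂ] V)) : Subalgebra ℂ (V →L[ℂ] V) :=
  (finitePropagation ρ).topologicalClosure

end Propagation

/-- A subalgebra `A` of `B` is closed under taking inverses in `B`: if `a ∈ A` is invertible
in `B`, then `a⁻¹ ∈ A`. -/
def ClosedUnderInverses {B : Type v} [Semiring B] [Algebra ℂ B] (A : Subalgebra ℂ B) : Prop :=
  ∀ a : Bˣ, (a : B) ∈ A → ((a⁻¹ : Bˣ) : B) ∈ A

/-! ### The representations of `C_b(X)` by pointwise multiplication -/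

section Representations

variable (X : Type u) [MetricSpace X] (E : Type v) [NormedAddCommGroup E] [NormedSpace ℂ E]

variable {X E} in
theorem norm_smul_apply_le (f : X →ᵇ ℂ) (ξ : X → E) (x : X) :
    ‖f x • ξ x‖ ≤ ‖((‖f‖ : ℝ) : ℂ) • ξ x‖ := by
  rw [norm_smul, norm_smul, Complex.norm_real, norm_norm]
  exact mul_le_mul_of_nonneg_right (f.norm_coe_le_norm x) (norm_nonneg _)

/-- Pointwise multiplication of `C_b(X)` on `ℓ^p(X; E)`, `p ∈ [1,∞]`. -/
def lpMul (p : ℝ≥0∞) [Fact (1 ≤ p)] :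
    (X →ᵇ ℂ) →ₐ[ℂ] (lp (fun _ : X => E) p →L[ℂ] lp (fun _ : X => E) p) :=
  AlgHom.ofLinearMap
    { toFun := fun f => LinearMap.mkContinuous
        { toFun := fun ξ => ⟨fun x => f x • ξ x, by
            refine ((lp.memℓp ξ).const_smul ((‖f‖ : ℝ) : ℂ)).mono' ?_
            exact norm_smul_apply_le f (ξ : X → E)⟩
          map_add' := fun ξ η => lp.ext (funext fun x => smul_add (f x) (ξ x) (η x))
          map_smul' := fun c ξ => lp.ext (funext fun x => smul_comm (f x) c (ξ x)) } ‖f‖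
        (fun ξ => by
          have hp : p ≠ 0 := (zero_lt_one.trans_le (Fact.out : 1 ≤ p)).ne'
          refine (lp.norm_mono (y := ((‖f‖ : ℝ) : ℂ) • ξ) hp
            (norm_smul_apply_le f (ξ : X → E))).trans ?_
          rw [lp.norm_const_smul hp, Complex.norm_real, norm_norm])
      map_add' := fun f g => by
        ext ξ x
        exact add_smul (f x) (g x) (ξ x)
      map_smul' := fun c f => by
        ext ξ x
        exact smul_assoc c (f x) (ξ x) }
    (by
      ext ξ x
      exact one_smul ℂ (ξ x))
    (fun f g => by
      ext ξ x
      exact mul_smul (f x) (g x) (ξ x))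

theorem lpMul_apply (p : ℝ≥0∞) [Fact (1 ≤ p)] (f : X →ᵇ ℂ) (ξ : lp (fun _ : X => E) p) (x : X) :
    lpMul X E p f ξ x = f x • ξ x := rfl

/-- Pointwise multiplication of `C_b(X)` on `c₀(X; E)`, the space of continuous functions
vanishing at infinity with the supremum norm. -/
def c0Mul : (X →ᵇ ℂ) →ₐ[ℂ] (C₀(X, E) →L[ℂ] C₀(X, E)) :=
  AlgHom.ofLinearMap
    { toFun := fun f => LinearMap.mkContinuous
        { toFun := fun ξ =>
            { toFun := fun x => f x • ξ x
              continuous_toFun := f.continuous.smul ξ.continuous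
              zero_at_infty' := by
                have h := (zero_at_infty ξ).norm.const_mul ‖f‖
                rw [norm_zero, mul_zero] at h
                refine squeeze_zero_norm (fun x => ?_) h
                exact (norm_smul_le (f x) (ξ x)).trans
                  (mul_le_mul_of_nonneg_right (f.norm_coe_le_norm x) (norm_nonneg _)) }
          map_add' := fun ξ η => ZeroAtInftyContinuousMap.ext fun x => smul_add (f x) (ξ x) (η x)
          map_smul' := fun c ξ => ZeroAtInftyContinuousMap.ext fun x =>
            smul_comm (f x) c (ξ x) } ‖f‖
        (fun ξ => by
          rw [← ZeroAtInftyContinuousMap.norm_toBCF_eq_norm]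
          refine (BoundedContinuousFunction.norm_le (by positivity)).2 fun x => ?_
          refine (norm_smul_le (f x) (ξ x)).trans ?_
          refine mul_le_mul (f.norm_coe_le_norm x) ?_ (norm_nonneg _) (norm_nonneg _)
          rw [← ZeroAtInftyContinuousMap.norm_toBCF_eq_norm]
          exact ξ.toBCF.norm_coe_le_norm x)
      map_add' := fun f g => by
        ext ξ x
        exact add_smul (f x) (g x) (ξ x)
      map_smul' := fun c f => by
        ext ξ x
        exact smul_assoc c (f x) (ξ x) }
    (by
      ext ξ x
      exact one_smul ℂ (ξ x))
    (fun f g => by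
      ext ξ x
      exact mul_smul (f x) (g x) (ξ x))

theorem c0Mul_apply (f : X →ᵇ ℂ) (ξ : C₀(X, E)) (x : X) : c0Mul X E f ξ x = f x • ξ x := rfl

/-- The band-dominated operator algebra `𝒜^p_E(X) ⊆ 𝔅(ℓ^p(X; E))`, `p ∈ [1,∞]`. -/
def bandDominated (p : ℝ≥0∞) [Fact (1 ≤ p)] :
    Subalgebra ℂ (lp (fun _ : X => E) p →L[ℂ] lp (fun _ : X => E) p) :=
  roeAlgebra (lpMul X E p)

/-- The band-dominated operator algebra `𝒜^0_E(X) ⊆ 𝔅(c₀(X; E))`. -/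
def bandDominatedZero : Subalgebra ℂ (C₀(X, E) →L[ℂ] C₀(X, E)) :=
  roeAlgebra (c0Mul X E)

/-- The `ℓ^p` uniform Roe algebra `B^p_u(X) ⊆ 𝔅(ℓ^p(X))`, `p ∈ [1,∞]`. -/
def uniformRoe (p : ℝ≥0∞) [Fact (1 ≤ p)] :
    Subalgebra ℂ (lp (fun _ : X => ℂ) p →L[ℂ] lp (fun _ : X => ℂ) p) :=
  roeAlgebra (lpMul X ℂ p)

/-- The uniform Roe algebra `B^0_u(X) ⊆ 𝔅(c₀(X))`. -/
def uniformRoeZero : Subalgebra ℂ (C₀(X, ℂ) →L[ℂ] C₀(X, ℂ)) :=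
  roeAlgebra (c0Mul X ℂ)

end Representations

end

/-!
The idea is to describe membership in the Roe algebra by commutators with slowly varying functions,
because commutators pass to inverses: `[f, a⁻¹] = -a⁻¹ [f, a] a⁻¹`.

On a space `X` of bounded geometry, which is automatically discrete, an operator `a` has finite
propagation if and only if, for some `R`, the value `(a ξ) x` depends only on the values of `ξ` on
`B(x, R)` (`IsLocal.mem_finitePropagation`, `IsEvaluation.exists_isLocal`). For such an operator the
commutator `[f, a]` at `x` sees only the differences `f x - f y` with `d(x, y) ≤ R`
(`IsLocal.commutator_apply`). So, after an approximation in norm, operators in the Roe algebra almost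
commute with slowly varying functions, and so do their inverses. For finite `p` this is true jointly
for a family of functions `φ i` with `∑ i, |φ i x| ^ p ≤ 1` whose joint `ℓ^p` variation is small:
`∑ i, ‖[φ i, a] η‖ ^ p ≤ ε ‖η‖ ^ p` (`tsum_commutator_le_of_mem_roeAlgebra`).

Conversely, an inverse `a⁻¹` which almost commutes with slowly varying functions is recovered from
its truncations.

* For `c₀` and `ℓ^∞`, let `f x` be a Lipschitz bump function at `x`, and let
  `(b ξ) x = (a⁻¹ (f x ξ)) x`. Then `((a⁻¹ - b) ξ) x = ([f x, a⁻¹] ξ) x`, so `a⁻¹ - b` is small in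
  the supremum norm.
* For `ℓ^1`, the columns of `a⁻¹` are truncated in the same way, and `a⁻¹ - b` is small because its
  norm is the supremum of the norms of its columns.
* For `1 < p < ∞`, Property A gives a partition `∑ i, ψ i ^ p = 1` of small variation: the powers
  `φ i ^ (q / p)` of a `q`-partition (`exists_abs_rpow_sub_rpow_le`, `PropertyA.exists_partition`).
  With `b = ∑ i, ψ i ^ (p - 1) a⁻¹ ψ i`, the difference is
  `a⁻¹ - b = ∑ i, ψ i ^ (p - 1) [ψ i, a⁻¹]`, which by Hölder's inequality and the joint commutator
  estimate is small.
-/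

/-! ### Spaces of bounded geometry -/

namespace BoundedGeometry

variable {X : Type u} [MetricSpace X]

theorem finite_closedBall (hX : BoundedGeometry X) (x : X) (R : ℝ) :
    (Metric.closedBall x R).Finite := by
  obtain ⟨N, hN⟩ := hX R
  exact Set.finite_of_encard_le_coe (hN x)

theorem discreteTopology (hX : BoundedGeometry X) : DiscreteTopology X :=
  discreteTopology_iff_isOpen_singleton.2 fun x =>
    isOpen_singleton_of_finite_mem_nhds x (Metric.closedBall_mem_nhds x one_pos)
      (hX.finite_closedBall x 1)

end BoundedGeometry

/-- The indicator function of a subset of a discrete space, as an element of `C_b(X)`. -/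
noncomputable def indicatorBCF {X : Type u} [MetricSpace X] [DiscreteTopology X] (A : Set X) :
    X →ᵇ ℂ :=
  BoundedContinuousFunction.ofNormedAddCommGroupDiscrete (A.indicator 1) 1 fun x => by
    by_cases hx : x ∈ A <;> simp [hx]

section Indicator

variable {X : Type u} [MetricSpace X] [DiscreteTopology X] {A : Set X} {x : X}

theorem indicatorBCF_of_mem (h : x ∈ A) : indicatorBCF A x = 1 :=
  Set.indicator_of_mem h _

theorem indicatorBCF_of_notMem (h : x ∉ A) : indicatorBCF A x = 0 :=
  Set.indicator_of_notMem h _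

theorem mem_of_mem_tsupport_indicatorBCF (h : x ∈ tsupport (indicatorBCF A)) : x ∈ A := by
  rw [tsupport, (isClosed_discrete _).closure_eq] at h
  by_contra hx
  exact h (indicatorBCF_of_notMem hx)

end Indicator

/-! ### Operators of finite propagation in terms of point evaluations -/

section Evaluations

variable {X : Type u} [MetricSpace X] {V E : Type*} [NormedAddCommGroup V] [NormedSpace ℂ V]
  [NormedAddCommGroup E] [NormedSpace ℂ E]

/-- `ev x : V → E` are the point evaluations of a representation `ρ` of `C_b(X)` on a space `V` of
`E`-valued functions on `X`: they separate the points of `V`, and `ρ` acts by pointwise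
multiplication. -/
structure IsEvaluation (ρ : (X →ᵇ ℂ) →ₐ[ℂ] (V →L[ℂ] V)) (ev : X → V →ₗ[ℂ] E) : Prop where
  map_apply : ∀ f ξ x, ev x (ρ f ξ) = f x • ev x ξ
  ext : ∀ ξ η, (∀ x, ev x ξ = ev x η) → ξ = η

/-- The value of `a ξ` at `x` depends only on the values of `ξ` on the closed ball `B(x, R)`. -/
def IsLocal (ev : X → V →ₗ[ℂ] E) (R : ℝ) (a : V →L[ℂ] V) : Prop :=
  ∀ x ξ, (∀ y, dist x y ≤ R → ev y ξ = 0) → ev x (a ξ) = 0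

variable {ρ : (X →ᵇ ℂ) →ₐ[ℂ] (V →L[ℂ] V)} {ev : X → V →ₗ[ℂ] E}

theorem IsLocal.congr {R : ℝ} {a : V →L[ℂ] V} (ha : IsLocal ev R a) {x : X} {ξ η : V}
    (h : ∀ y, dist x y ≤ R → ev y ξ = ev y η) : ev x (a ξ) = ev x (a η) := by
  have := ha x (ξ - η) fun y hy => by rw [map_sub, h y hy, sub_self]
  rwa [map_sub, map_sub, sub_eq_zero] at this

theorem IsLocal.mem_finitePropagation (hev : IsEvaluation ρ ev) {R : ℝ} {a : V →L[ℂ] V}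
    (ha : IsLocal ev R a) : a ∈ finitePropagation ρ := by
  -- `le_dist_of_lt_setEDist` gives a weak inequality, hence the summand `1`.
  refine ⟨(|R| + 1).toNNReal, fun f f' hff' => ?_⟩
  ext ξ
  refine hev.ext _ _ fun x => ?_
  rw [zero_apply, map_zero]
  change ev x (ρ f (a (ρ f' ξ))) = 0
  rw [hev.map_apply]
  by_cases hx : f x = 0
  · rw [hx, zero_smul]
  rw [ha x, smul_zero]
  intro y hy
  rw [hev.map_apply]
  by_cases hy' : f' y = 0
  · rw [hy', zero_smul]
  have := le_dist_of_lt_setEDist hff' (subset_tsupport _ hx) (subset_tsupport _ hy')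
  linarith [le_abs_self R]

theorem IsEvaluation.exists_isLocal [DiscreteTopology X] (hev : IsEvaluation ρ ev) {a : V →L[ℂ] V}
    (ha : a ∈ finitePropagation ρ) : ∃ R : ℝ, 0 < R ∧ IsLocal ev R a := by
  obtain ⟨R, hR⟩ := ha
  refine ⟨R + 1, by positivity, fun x ξ hξ => ?_⟩
  have h0 := hR (indicatorBCF {x}) (indicatorBCF {y | ¬ dist x y ≤ R + 1}) <| by
    have := lt_setEDist (A := tsupport (indicatorBCF {x}))
      (B := tsupport (indicatorBCF {y | ¬ dist x y ≤ R + 1})) R.2 (lt_add_one (R : ℝ))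
      fun z hz y hy => by
        rw [Set.mem_singleton_iff.1 (mem_of_mem_tsupport_indicatorBCF hz)]
        exact (not_le.1 (mem_of_mem_tsupport_indicatorBCF hy)).le
    simpa using this
  have h1 : ρ (indicatorBCF {y | ¬ dist x y ≤ R + 1}) ξ = ξ := by
    refine hev.ext _ _ fun y => ?_
    rw [hev.map_apply]
    by_cases hy : dist x y ≤ R + 1
    · rw [hξ y hy, smul_zero]
    · rw [indicatorBCF_of_mem (show y ∈ {y | ¬ dist x y ≤ R + 1} from hy), one_smul]
  have h2 : ev x (ρ (indicatorBCF {x}) (a (ρ (indicatorBCF {y | ¬ dist x y ≤ R + 1}) ξ))) = 0 := by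
    have := congrArg (fun T : V →L[ℂ] V => ev x (T ξ)) h0
    simpa using this
  rwa [h1, hev.map_apply, indicatorBCF_of_mem (Set.mem_singleton x), one_smul] at h2

/-- A commutator with a local operator sees a function `φ` only through its variation over balls
of the radius of locality. -/
theorem IsLocal.commutator_apply [DiscreteTopology X] (hev : IsEvaluation ρ ev) {R : ℝ}
    {c : V →L[ℂ] V} (hc : IsLocal ev R c) (φ : X →ᵇ ℂ) (η : V) (x : X) :
    ev x (ρ φ (c η) - c (ρ φ η)) =
      ev x (c (ρ (indicatorBCF (Metric.closedBall x R) *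
        (BoundedContinuousFunction.const X (φ x) - φ)) η)) := by
  have h : ev x (ρ φ (c η) - c (ρ φ η)) = ev x (c (φ x • η - ρ φ η)) := by
    rw [map_sub, map_sub, map_sub, hev.map_apply, map_smul, map_smul]
  rw [h]
  refine hc.congr fun y hy => ?_
  rw [hev.map_apply, map_sub, map_smul, hev.map_apply, BoundedContinuousFunction.mul_apply,
    indicatorBCF_of_mem (Metric.mem_closedBall'.2 hy), one_mul,
    BoundedContinuousFunction.sub_apply, BoundedContinuousFunction.const_apply, sub_smul]

/-- Passing to the inverse conjugates a commutator by the inverse. -/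
theorem commutator_inv_apply (a : (V →L[ℂ] V)ˣ) (T : V →L[ℂ] V) (η : V) :
    T ((a⁻¹ : (V →L[ℂ] V)ˣ).1 η) - (a⁻¹ : (V →L[ℂ] V)ˣ).1 (T η) =
      -(a⁻¹ : (V →L[ℂ] V)ˣ).1 (T (a.1 ((a⁻¹ : (V →L[ℂ] V)ˣ).1 η)) -
        a.1 (T ((a⁻¹ : (V →L[ℂ] V)ˣ).1 η))) := by
  have h1 : ∀ ζ, a.1 ((a⁻¹ : (V →L[ℂ] V)ˣ).1 ζ) = ζ := fun ζ =>
    congrArg (fun S : V →L[ℂ] V => S ζ) a.mul_inv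
  have h2 : ∀ ζ, (a⁻¹ : (V →L[ℂ] V)ˣ).1 (a.1 ζ) = ζ := fun ζ =>
    congrArg (fun S : V →L[ℂ] V => S ζ) a.inv_mul
  rw [h1, map_sub, h2, neg_sub]

theorem mem_roeAlgebra_iff {a : V →L[ℂ] V} :
    a ∈ roeAlgebra ρ ↔ ∀ ε > 0, ∃ c ∈ finitePropagation ρ, ‖a - c‖ < ε := by
  rw [roeAlgebra, ← SetLike.mem_coe, Subalgebra.topologicalClosure_coe, Metric.mem_closure_iff]
  simp only [dist_eq_norm, SetLike.mem_coe]

end Evaluations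

/-! ### Lipschitz bump functions -/

section Bump

variable {X : Type u} [MetricSpace X]

/-- The bump function `y ↦ max 0 (1 - d(x, y) / S)`, which is `1` at `x`, vanishes at distance at
least `S` from `x`, and has Lipschitz constant `1 / S`. -/
noncomputable def bump (S : ℝ) (x : X) : X →ᵇ ℂ :=
  BoundedContinuousFunction.ofNormedAddCommGroup
    (fun y => ((max 0 (1 - dist x y / S.toNNReal) : ℝ) : ℂ)) (by fun_prop) 1 fun y => by
      rw [Complex.norm_real, Real.norm_of_nonneg (le_max_left _ _)]
      exact max_le zero_le_one (sub_le_self _ (by positivity))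

theorem bump_apply {S : ℝ} (hS : 0 < S) (x y : X) :
    bump S x y = ((max 0 (1 - dist x y / S) : ℝ) : ℂ) := by
  rw [bump, BoundedContinuousFunction.coe_ofNormedAddCommGroup, Real.coe_toNNReal _ hS.le]

theorem bump_self (S : ℝ) (x : X) : bump S x x = 1 := by simp [bump]

theorem norm_bump_le (S : ℝ) (x : X) : ‖bump S x‖ ≤ 1 :=
  BoundedContinuousFunction.norm_ofNormedAddCommGroup_le _ zero_le_one _

theorem bump_eq_zero {S : ℝ} (hS : 0 < S) {x y : X} (h : S ≤ dist x y) : bump S x y = 0 := by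
  rw [bump_apply hS, max_eq_left (sub_nonpos.2 ((one_le_div hS).2 h)), Complex.ofReal_zero]

theorem norm_bump_sub_le {S : ℝ} (hS : 0 < S) (x y z : X) :
    ‖bump S x y - bump S x z‖ ≤ dist y z / S := by
  rw [bump_apply hS, bump_apply hS, ← Complex.ofReal_sub, Complex.norm_real, Real.norm_eq_abs]
  refine (abs_max_sub_max_le_max _ _ _ _).trans ?_
  rw [sub_self, abs_zero, max_eq_right (abs_nonneg _), sub_sub_sub_cancel_left, ← sub_div, abs_div,
    abs_of_pos hS]
  gcongr
  rw [dist_comm x z, dist_comm x y, dist_comm y z]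
  exact abs_dist_sub_le z y x

end Bump

/-! ### Supremum norms -/

section SupNorm

variable {X : Type u} [MetricSpace X] [DiscreteTopology X] {V E : Type*} [NormedAddCommGroup V]
  [NormedSpace ℂ V] [NormedAddCommGroup E] [NormedSpace ℂ E]
  {ρ : (X →ᵇ ℂ) →ₐ[ℂ] (V →L[ℂ] V)} {ev : X → V →ₗ[ℂ] E}

theorem norm_commutator_le_of_norm_le_iff (hev : IsEvaluation ρ ev)
    (hsup : ∀ ξ C, 0 ≤ C → (‖ξ‖ ≤ C ↔ ∀ x, ‖ev x ξ‖ ≤ C)) {a : V →L[ℂ] V}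
    (ha : a ∈ roeAlgebra ρ) {ε : ℝ} (hε : 0 < ε) :
    ∃ R > 0, ∃ δ > 0, ∀ φ : X →ᵇ ℂ, ‖φ‖ ≤ 1 → (∀ x y, dist x y ≤ R → ‖φ x - φ y‖ ≤ δ) →
      ∀ η, ‖ρ φ (a η) - a (ρ φ η)‖ ≤ ε * ‖η‖ := by
  obtain ⟨c, hc, hac⟩ := mem_roeAlgebra_iff.1 ha (ε / 4) (by positivity)
  obtain ⟨R, hR, hcR⟩ := hev.exists_isLocal hc
  -- The summand `1` avoids a division by zero if `c = 0`.
  refine ⟨R, hR, ε / (2 * (‖c‖ + 1)), by positivity, fun φ hφ hvar η => ?_⟩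
  have hle : ∀ ξ x, ‖ev x ξ‖ ≤ ‖ξ‖ := fun ξ => (hsup ξ _ (norm_nonneg _)).1 le_rfl
  have hρ : ∀ ξ, ‖ρ φ ξ‖ ≤ ‖ξ‖ := fun ξ => (hsup _ _ (norm_nonneg _)).2 fun x => by
    rw [hev.map_apply, norm_smul]
    exact (mul_le_of_le_one_left (norm_nonneg _) ((φ.norm_coe_le_norm x).trans hφ)).trans (hle ξ x)
  have hcφ : ‖ρ φ (c η) - c (ρ φ η)‖ ≤ ε / 2 * ‖η‖ := by
    refine (hsup _ _ (by positivity)).2 fun x => ?_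
    rw [hcR.commutator_apply hev]
    refine (hle _ x).trans ((c.le_opNorm _).trans ?_)
    have h1 : ‖ρ (indicatorBCF (Metric.closedBall x R) *
        (BoundedContinuousFunction.const X (φ x) - φ)) η‖ ≤ ε / (2 * (‖c‖ + 1)) * ‖η‖ := by
      refine (hsup _ _ (by positivity)).2 fun y => ?_
      rw [hev.map_apply, norm_smul]
      refine mul_le_mul ?_ (hle η y) (norm_nonneg _) (by positivity)
      rw [BoundedContinuousFunction.mul_apply]
      by_cases hy : y ∈ Metric.closedBall x R
      · rw [indicatorBCF_of_mem hy, one_mul]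
        exact hvar x y (Metric.mem_closedBall'.1 hy)
      · rw [indicatorBCF_of_notMem hy, zero_mul, norm_zero]
        positivity
    calc ‖c‖ * _ ≤ (‖c‖ + 1) * (ε / (2 * (‖c‖ + 1)) * ‖η‖) :=
          mul_le_mul (by linarith) h1 (norm_nonneg _) (by positivity)
      _ = ε / 2 * ‖η‖ := by field_simp
  have hd : ∀ ξ, ‖(a - c) ξ‖ ≤ ε / 4 * ‖ξ‖ := fun ξ => (a - c).le_of_opNorm_le hac.le ξ
  have hsplit : ρ φ (a η) - a (ρ φ η) =
      (ρ φ (c η) - c (ρ φ η)) + (ρ φ ((a - c) η) - (a - c) (ρ φ η)) := by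
    simp only [sub_apply, map_sub]
    abel
  rw [hsplit]
  refine (norm_add_le_of_le hcφ (norm_sub_le_of_le ((hρ _).trans (hd η))
    ((hd _).trans (mul_le_mul_of_nonneg_left (hρ η) (by positivity))))).trans (le_of_eq ?_)
  ring

/-- If the norm of `V` is a supremum norm, then the inverse of an operator in the Roe algebra is
approximated by the operators `b` whose rows are those of the inverse, cut off by bump functions.
Such operators exist by the assumption `hglue`. -/
theorem closedUnderInverses_of_norm_le_iff (hev : IsEvaluation ρ ev)
    (hsup : ∀ ξ C, 0 ≤ C → (‖ξ‖ ≤ C ↔ ∀ x, ‖ev x ξ‖ ≤ C))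
    (hglue : ∀ (a : V →L[ℂ] V) (S : ℝ) (f : X → X →ᵇ ℂ), (∀ x, ‖f x‖ ≤ 1) →
      (∀ x y, S ≤ dist x y → f x y = 0) → ∃ b : V →L[ℂ] V, ∀ ξ x, ev x (b ξ) = ev x (a (ρ (f x) ξ))) :
    ClosedUnderInverses (roeAlgebra ρ) := by
  intro a ha
  refine mem_roeAlgebra_iff.2 fun ε hε => ?_
  set a' : V →L[ℂ] V := (a⁻¹ : (V →L[ℂ] V)ˣ).1 with ha'
  have hκ : 0 < ε / (2 * (‖a'‖ * ‖a'‖ + 1)) := by positivity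
  obtain ⟨R, hR, δ, hδ, hcomm⟩ := norm_commutator_le_of_norm_le_iff hev hsup ha hκ
  -- At radius `R / δ`, the bump functions vary by at most `δ` at distance `R`.
  have hS : 0 < R / δ := by positivity
  have hcomm' : ∀ x η, ‖ρ (bump (R / δ) x) (a' η) - a' (ρ (bump (R / δ) x) η)‖ ≤ ε / 2 * ‖η‖ := by
    intro x η
    rw [ha', commutator_inv_apply, ← ha', norm_neg]
    have h1 := hcomm (bump (R / δ) x) (norm_bump_le _ x) (fun y z hyz =>
      (norm_bump_sub_le hS x y z).trans (by rw [div_div_eq_mul_div, div_le_iff₀ hR]; nlinarith))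
      (a' η)
    calc _ ≤ ‖a'‖ * (ε / (2 * (‖a'‖ * ‖a'‖ + 1)) * (‖a'‖ * ‖η‖)) :=
          a'.le_opNorm_of_le (h1.trans (by gcongr; exact a'.le_opNorm η))
      _ = (‖a'‖ * ‖a'‖) * (ε / (2 * (‖a'‖ * ‖a'‖ + 1)) * ‖η‖) := by ring
      _ ≤ (‖a'‖ * ‖a'‖ + 1) * (ε / (2 * (‖a'‖ * ‖a'‖ + 1)) * ‖η‖) := by gcongr; linarith
      _ = ε / 2 * ‖η‖ := by field_simp
  obtain ⟨b, hb⟩ := hglue a' (R / δ) (bump (R / δ)) (norm_bump_le _) fun x y => bump_eq_zero hS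
  refine ⟨b, IsLocal.mem_finitePropagation hev (R := R / δ) fun x ξ hξ => ?_, ?_⟩
  · have : ρ (bump (R / δ) x) ξ = 0 := hev.ext _ _ fun y => by
      rw [hev.map_apply, map_zero]
      rcases le_total (dist x y) (R / δ) with h | h
      · rw [hξ y h, smul_zero]
      · rw [bump_eq_zero hS h, zero_smul]
    rw [hb, this, map_zero, map_zero]
  · refine lt_of_le_of_lt (ContinuousLinearMap.opNorm_le_bound _ (half_pos hε).le fun ξ => ?_)
      (half_lt_self hε)
    refine (hsup _ _ (by positivity)).2 fun x => ?_
    have h1 : ev x ((a' - b) ξ) = ev x (ρ (bump (R / δ) x) (a' ξ) - a' (ρ (bump (R / δ) x) ξ)) := by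
      rw [sub_apply, map_sub, map_sub, hb, hev.map_apply, bump_self, one_smul]
    rw [h1]
    exact ((hsup _ _ (norm_nonneg _)).1 le_rfl x).trans (hcomm' x ξ)

end SupNorm

section Instances

variable {X : Type u} [MetricSpace X] {E : Type v} [NormedAddCommGroup E] [NormedSpace ℂ E]

/-- The point evaluations on `ℓ^p(X; E)`. -/
def lpEval (X : Type u) (E : Type v) [NormedAddCommGroup E] [NormedSpace ℂ E] (p : ℝ≥0∞) (x : X) :
    lp (fun _ : X => E) p →ₗ[ℂ] E where
  toFun ξ := ξ x
  map_add' _ _ := rfl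
  map_smul' _ _ := rfl

theorem isEvaluation_lpEval (p : ℝ≥0∞) [Fact (1 ≤ p)] :
    IsEvaluation (lpMul X E p) (lpEval X E p) where
  map_apply _ _ _ := rfl
  ext _ _ h := lp.ext (funext h)

theorem closedUnderInverses_bandDominated_top [DiscreteTopology X] :
    ClosedUnderInverses (bandDominated X E ∞) := by
  have hsup : ∀ (ξ : lp (fun _ : X => E) ∞) C, 0 ≤ C →
      (‖ξ‖ ≤ C ↔ ∀ x, ‖lpEval X E ∞ x ξ‖ ≤ C) := fun ξ C hC =>
    ⟨fun h x => (lp.norm_apply_le_norm ENNReal.top_ne_zero ξ x).trans h,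
      fun h => lp.norm_le_of_forall_le hC h⟩
  refine closedUnderInverses_of_norm_le_iff (isEvaluation_lpEval ∞) hsup fun a S f hf _ => ?_
  have hbound : ∀ ξ x, ‖a (lpMul X E ∞ (f x) ξ) x‖ ≤ ‖a‖ * ‖ξ‖ := fun ξ x => by
    refine (lp.norm_apply_le_norm ENNReal.top_ne_zero _ x).trans (a.le_opNorm_of_le ?_)
    refine (hsup _ _ (norm_nonneg _)).2 fun y => ?_
    change ‖f x y • ξ y‖ ≤ _
    rw [norm_smul]
    exact (mul_le_of_le_one_left (norm_nonneg _) (((f x).norm_coe_le_norm y).trans (hf x))).trans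
      (lp.norm_apply_le_norm ENNReal.top_ne_zero ξ y)
  refine ⟨LinearMap.mkContinuous
    { toFun := fun ξ => ⟨fun x => a (lpMul X E ∞ (f x) ξ) x,
        memℓp_infty ⟨‖a‖ * ‖ξ‖, by rintro _ ⟨x, rfl⟩; exact hbound ξ x⟩⟩
      map_add' := fun ξ η => lp.ext (funext fun x => by
        change a (lpMul X E ∞ (f x) (ξ + η)) x = _
        rw [map_add, map_add]; rfl)
      map_smul' := fun c ξ => lp.ext (funext fun x => by
        change a (lpMul X E ∞ (f x) (c • ξ)) x = _
        rw [map_smul, map_smul]; rfl) } ‖a‖ fun ξ =>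
      lp.norm_le_of_forall_le (by positivity) (hbound ξ), fun ξ x => rfl⟩

/-- The point evaluations on `c₀(X; E)`. -/
def c0Eval (X : Type u) [MetricSpace X] (E : Type v) [NormedAddCommGroup E] [NormedSpace ℂ E]
    (x : X) : C₀(X, E) →ₗ[ℂ] E where
  toFun ξ := ξ x
  map_add' _ _ := rfl
  map_smul' _ _ := rfl

theorem isEvaluation_c0Eval : IsEvaluation (c0Mul X E) (c0Eval X E) where
  map_apply _ _ _ := rfl
  ext _ _ h := ZeroAtInftyContinuousMap.ext h

theorem closedUnderInverses_bandDominatedZero (hX : BoundedGeometry X) :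
    ClosedUnderInverses (bandDominatedZero X E) := by
  have := hX.discreteTopology
  have hsup : ∀ (ξ : C₀(X, E)) C, 0 ≤ C → (‖ξ‖ ≤ C ↔ ∀ x, ‖c0Eval X E x ξ‖ ≤ C) :=
    fun ξ C hC => by
      rw [← ZeroAtInftyContinuousMap.norm_toBCF_eq_norm]
      exact BoundedContinuousFunction.norm_le hC
  refine closedUnderInverses_of_norm_le_iff isEvaluation_c0Eval hsup fun a S f hf hfS => ?_
  have hle : ∀ (ξ : C₀(X, E)) x, ‖ξ x‖ ≤ ‖ξ‖ := fun ξ => (hsup ξ _ (norm_nonneg _)).1 le_rfl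
  have hfle : ∀ (ξ : C₀(X, E)) x y, ‖f x y • ξ y‖ ≤ ‖ξ y‖ := fun ξ x y => by
    rw [norm_smul]
    exact mul_le_of_le_one_left (norm_nonneg _) (((f x).norm_coe_le_norm y).trans (hf x))
  have hbound : ∀ ξ x, ‖a (c0Mul X E (f x) ξ) x‖ ≤ ‖a‖ * ‖ξ‖ := fun ξ x =>
    (hle _ x).trans (a.le_opNorm_of_le
      ((hsup _ _ (norm_nonneg _)).2 fun y => (hfle ξ x y).trans (hle ξ y)))
  have hzero : ∀ ξ, Filter.Tendsto (fun x => a (c0Mul X E (f x) ξ) x) (Filter.cocompact X)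
      (nhds 0) := fun ξ => by
    rw [Filter.cocompact_eq_cofinite, Metric.tendsto_nhds]
    intro ε hε
    have hfin := Metric.tendsto_nhds.1 (zero_at_infty ξ) (ε / (2 * (‖a‖ + 1))) (by positivity)
    rw [Filter.cocompact_eq_cofinite, Filter.eventually_cofinite] at hfin
    rw [Filter.eventually_cofinite]
    -- Where `a (f x • ξ) x` is large, `ξ` is large at distance less than `S` from `x`.
    refine (hfin.biUnion fun y _ => hX.finite_closedBall y S).subset fun x hx => ?_
    by_contra hxn
    simp only [Set.mem_iUnion, not_exists] at hxn
    refine hx (lt_of_le_of_lt ?_ (half_lt_self hε))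
    rw [dist_zero_right]
    have h1 : ‖c0Mul X E (f x) ξ‖ ≤ ε / (2 * (‖a‖ + 1)) := by
      refine (hsup _ _ (by positivity)).2 fun y => ?_
      change ‖f x y • ξ y‖ ≤ _
      rcases le_total S (dist x y) with h | h
      · rw [hfS x y h, zero_smul, norm_zero]
        positivity
      · refine (hfle ξ x y).trans ?_
        by_contra hy
        refine hxn y (fun hlt => hy ?_) (Metric.mem_closedBall.2 h)
        rw [dist_zero_right] at hlt
        exact hlt.le
    calc _ ≤ ‖a‖ * (ε / (2 * (‖a‖ + 1))) := (hle _ x).trans (a.le_opNorm_of_le h1)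
      _ ≤ (‖a‖ + 1) * (ε / (2 * (‖a‖ + 1))) := by gcongr; linarith
      _ = ε / 2 := by field_simp
  refine ⟨LinearMap.mkContinuous
    { toFun := fun ξ =>
        { toFun := fun x => a (c0Mul X E (f x) ξ) x
          continuous_toFun := continuous_of_discreteTopology
          zero_at_infty' := hzero ξ }
      map_add' := fun ξ η => ZeroAtInftyContinuousMap.ext fun x => by
        change a (c0Mul X E (f x) (ξ + η)) x = _
        rw [map_add, map_add]; rfl
      map_smul' := fun c ξ => ZeroAtInftyContinuousMap.ext fun x => by
        change a (c0Mul X E (f x) (c • ξ)) x = _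
        rw [map_smul, map_smul]; rfl } ‖a‖ fun ξ =>
      (hsup _ _ (by positivity)).2 (hbound ξ), fun ξ x => rfl⟩

end Instances

/-! ### Operators on `ℓ^p` for finite `p` -/

section FiniteExponent

variable {X : Type u} [MetricSpace X] {E : Type v} [NormedAddCommGroup E] [NormedSpace ℂ E]
  {p : ℝ≥0∞} [Fact (1 ≤ p)]

theorem one_le_toReal_of_ne_top (hp : p ≠ ∞) : 1 ≤ p.toReal :=
  ENNReal.toReal_one ▸ ENNReal.toReal_mono hp Fact.out

omit [MetricSpace X] [NormedSpace ℂ E] in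
theorem lp_enorm_rpow_eq_tsum (hp : p ≠ ∞) (ξ : lp (fun _ : X => E) p) :
    ‖ξ‖ₑ ^ p.toReal = ∑' x, ‖ξ x‖ₑ ^ p.toReal := by
  have hp0 : 0 < p.toReal := one_pos.trans_le (one_le_toReal_of_ne_top hp)
  rw [← ofReal_norm, ENNReal.ofReal_rpow_of_nonneg (norm_nonneg _) hp0.le,
    lp.norm_rpow_eq_tsum hp0, ENNReal.ofReal_tsum_of_nonneg (fun x => by positivity)
      ((lp.memℓp ξ).summable hp0)]
  refine tsum_congr fun x => ?_
  rw [← ENNReal.ofReal_rpow_of_nonneg (norm_nonneg _) hp0.le, ofReal_norm]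

theorem opENorm_rpow_le {V : Type*} [NormedAddCommGroup V] [NormedSpace ℂ V] (T : V →L[ℂ] V) (ξ : V)
    {P : ℝ} (hP : 0 ≤ P) : ‖T ξ‖ₑ ^ P ≤ ‖T‖ₑ ^ P * ‖ξ‖ₑ ^ P := by
  rw [← ENNReal.mul_rpow_of_nonneg _ _ hP]
  exact ENNReal.rpow_le_rpow (T.le_opENorm ξ) hP

omit [MetricSpace X] in
/-- A linear map from `ℓ^p` to functions which satisfies an `ℓ^p` bound is a bounded operator
on `ℓ^p`. -/
theorem exists_lp_operator (hp : p ≠ ∞) (L : lp (fun _ : X => E) p →ₗ[ℂ] (X → E)) (C : ℝ≥0)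
    (hL : ∀ ξ, ∑' x, ‖L ξ x‖ₑ ^ p.toReal ≤ (C : ℝ≥0∞) ^ p.toReal * ‖ξ‖ₑ ^ p.toReal) :
    ∃ T : lp (fun _ : X => E) p →L[ℂ] lp (fun _ : X => E) p, ‖T‖ ≤ C ∧ ∀ ξ x, T ξ x = L ξ x := by
  have hp0 : 0 < p.toReal := one_pos.trans_le (one_le_toReal_of_ne_top hp)
  have hmem : ∀ ξ, Memℓp (E := fun _ : X => E) (L ξ) p := fun ξ => by
    refine memℓp_gen ?_
    have h1 : ∑' x, ‖L ξ x‖ₑ ^ p.toReal ≠ ∞ := ne_top_of_le_ne_top (by finiteness) (hL ξ)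
    refine (ENNReal.summable_toReal h1).congr fun x => ?_
    rw [← ENNReal.toReal_rpow, toReal_enorm]
  have hle : ∀ ξ, ‖(⟨L ξ, hmem ξ⟩ : lp (fun _ : X => E) p)‖ ≤ C * ‖ξ‖ := fun ξ => by
    have h1 : ‖(⟨L ξ, hmem ξ⟩ : lp (fun _ : X => E) p)‖ₑ ≤ C * ‖ξ‖ₑ := by
      rw [← ENNReal.rpow_le_rpow_iff hp0, lp_enorm_rpow_eq_tsum hp,
        ENNReal.mul_rpow_of_nonneg _ _ hp0.le]
      exact hL ξ
    have h2 := ENNReal.toReal_mono (by finiteness) h1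
    rwa [ENNReal.toReal_mul, toReal_enorm, toReal_enorm, ENNReal.coe_toReal] at h2
  let L' : lp (fun _ : X => E) p →ₗ[ℂ] lp (fun _ : X => E) p :=
    { toFun := fun ξ => ⟨L ξ, hmem ξ⟩
      map_add' := fun ξ η => lp.ext (map_add L ξ η)
      map_smul' := fun c ξ => lp.ext (map_smul L c ξ) }
  exact ⟨L'.mkContinuous C hle, L'.mkContinuous_norm_le C.2 hle, fun ξ x => rfl⟩

theorem tsum_indicator_closedBall_le {R : ℝ} {N : ℕ}
    (hN : ∀ x : X, (Metric.closedBall x R).encard ≤ N) (y : X) :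
    ∑' x, (Metric.closedBall y R).indicator (1 : X → ℝ≥0∞) x ≤ N := by
  rw [← tsum_subtype]
  simp only [Pi.one_apply]
  rw [ENNReal.tsum_set_one]
  exact_mod_cast hN y

variable {ι : Type*}

/-- The commutators of a local operator with a family of functions of small joint `ℓ^p` variation
are jointly small. -/
theorem tsum_commutator_le_of_isLocal [DiscreteTopology X] (hp : p ≠ ∞) {R : ℝ} {N : ℕ}
    (hN : ∀ x : X, (Metric.closedBall x R).encard ≤ N)
    {c : lp (fun _ : X => E) p →L[ℂ] lp (fun _ : X => E) p} (hc : IsLocal (lpEval X E p) R c)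
    (φ : ι → X →ᵇ ℂ) {δ : ℝ≥0∞}
    (hφ : ∀ x y, dist x y ≤ R → ∑' i, ‖φ i x - φ i y‖ₑ ^ p.toReal ≤ δ)
    (η : lp (fun _ : X => E) p) :
    ∑' i, ‖lpMul X E p (φ i) (c η) - c (lpMul X E p (φ i) η)‖ₑ ^ p.toReal ≤
      ‖c‖ₑ ^ p.toReal * N * δ * ‖η‖ₑ ^ p.toReal := by
  have hp1 := one_le_toReal_of_ne_top hp
  set P := p.toReal
  have hP : 0 < P := by linarith
  have hpt : ∀ i x, ‖(lpMul X E p (φ i) (c η) - c (lpMul X E p (φ i) η)) x‖ₑ ^ P ≤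
      ‖c‖ₑ ^ P * ∑' y, (Metric.closedBall y R).indicator (1 : X → ℝ≥0∞) x *
        (‖φ i x - φ i y‖ₑ ^ P * ‖η y‖ₑ ^ P) := fun i x => by
    have h1 := hc.commutator_apply (isEvaluation_lpEval p) (φ i) η x
    set ζ := lpMul X E p (indicatorBCF (Metric.closedBall x R) *
      (BoundedContinuousFunction.const X (φ i x) - φ i)) η with hζ
    change (lpMul X E p (φ i) (c η) - c (lpMul X E p (φ i) η)) x = (c ζ) x at h1
    rw [h1]
    calc ‖(c ζ) x‖ₑ ^ P ≤ ‖c ζ‖ₑ ^ P := by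
          rw [lp_enorm_rpow_eq_tsum hp]
          exact ENNReal.le_tsum x
      _ ≤ ‖c‖ₑ ^ P * ‖ζ‖ₑ ^ P := opENorm_rpow_le c ζ hP.le
      _ = _ := by
        rw [lp_enorm_rpow_eq_tsum hp]
        congr 1
        refine tsum_congr fun y => ?_
        rw [hζ, lpMul_apply, enorm_smul, BoundedContinuousFunction.mul_apply,
          BoundedContinuousFunction.sub_apply, BoundedContinuousFunction.const_apply]
        by_cases hy : y ∈ Metric.closedBall x R
        · rw [indicatorBCF_of_mem hy, one_mul, ENNReal.mul_rpow_of_nonneg _ _ hP.le,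
            Set.indicator_of_mem (Metric.mem_closedBall_comm.1 hy), Pi.one_apply, one_mul]
        · rw [indicatorBCF_of_notMem hy, zero_mul, enorm_zero, zero_mul,
            ENNReal.zero_rpow_of_pos hP,
            Set.indicator_of_notMem (fun h => hy (Metric.mem_closedBall_comm.1 h)), zero_mul]
  calc ∑' i, ‖lpMul X E p (φ i) (c η) - c (lpMul X E p (φ i) η)‖ₑ ^ P
      = ∑' i, ∑' x, ‖(lpMul X E p (φ i) (c η) - c (lpMul X E p (φ i) η)) x‖ₑ ^ P :=
        tsum_congr fun i => lp_enorm_rpow_eq_tsum hp _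
    _ ≤ ∑' i, ∑' x, ‖c‖ₑ ^ P * ∑' y, (Metric.closedBall y R).indicator (1 : X → ℝ≥0∞) x *
        (‖φ i x - φ i y‖ₑ ^ P * ‖η y‖ₑ ^ P) :=
        ENNReal.tsum_le_tsum fun i => ENNReal.tsum_le_tsum fun x => hpt i x
    _ = ‖c‖ₑ ^ P * ∑' y, ∑' x, (Metric.closedBall y R).indicator (1 : X → ℝ≥0∞) x *
        ((∑' i, ‖φ i x - φ i y‖ₑ ^ P) * ‖η y‖ₑ ^ P) := by
        simp_rw [ENNReal.tsum_mul_left]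
        rw [ENNReal.tsum_comm]
        congr 1
        simp_rw [← ENNReal.tsum_mul_right, ← ENNReal.tsum_mul_left]
        rw [eq_comm, ENNReal.tsum_comm]
        exact tsum_congr fun x => ENNReal.tsum_comm
    _ ≤ ‖c‖ₑ ^ P * ∑' y, ∑' x, (Metric.closedBall y R).indicator (1 : X → ℝ≥0∞) x *
        (δ * ‖η y‖ₑ ^ P) := by
        gcongr ‖c‖ₑ ^ P * ?_
        refine ENNReal.tsum_le_tsum fun y => ENNReal.tsum_le_tsum fun x => ?_
        by_cases hx : x ∈ Metric.closedBall y R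
        · gcongr
          exact hφ x y (Metric.mem_closedBall.1 hx)
        · rw [Set.indicator_of_notMem hx, zero_mul, zero_mul]
    _ ≤ ‖c‖ₑ ^ P * ∑' y, N * (δ * ‖η y‖ₑ ^ P) := by
        gcongr ‖c‖ₑ ^ P * ?_
        refine ENNReal.tsum_le_tsum fun y => ?_
        rw [ENNReal.tsum_mul_right]
        gcongr
        exact tsum_indicator_closedBall_le hN y
    _ = ‖c‖ₑ ^ P * N * δ * ‖η‖ₑ ^ P := by
        rw [lp_enorm_rpow_eq_tsum hp, ENNReal.tsum_mul_left, ENNReal.tsum_mul_left]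
        ring

theorem tsum_lpMul_le (hp : p ≠ ∞) (φ : ι → X →ᵇ ℂ)
    (hφ : ∀ x, ∑' i, ‖φ i x‖ₑ ^ p.toReal ≤ 1) (ξ : lp (fun _ : X => E) p) :
    ∑' i, ‖lpMul X E p (φ i) ξ‖ₑ ^ p.toReal ≤ ‖ξ‖ₑ ^ p.toReal := by
  simp_rw [lp_enorm_rpow_eq_tsum hp]
  rw [ENNReal.tsum_comm]
  refine ENNReal.tsum_le_tsum fun x => ?_
  simp_rw [lpMul_apply, enorm_smul, ENNReal.mul_rpow_of_nonneg _ _ ENNReal.toReal_nonneg]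
  rw [ENNReal.tsum_mul_right]
  exact mul_le_of_le_one_left zero_le (hφ x)

/-- An operator in the Roe algebra almost commutes with any family of functions which has `ℓ^p` norm
at most `1` at each point and sufficiently small `ℓ^p` variation, jointly in the family. -/
theorem tsum_commutator_le_of_mem_roeAlgebra (hX : BoundedGeometry X) (hp : p ≠ ∞)
    {a : lp (fun _ : X => E) p →L[ℂ] lp (fun _ : X => E) p} (ha : a ∈ bandDominated X E p)
    {ε : ℝ≥0∞} (hε : ε ≠ 0) :
    ∃ R : ℝ, 0 < R ∧ ∃ δ : ℝ≥0, 0 < δ ∧ ∀ (ι : Type u) (φ : ι → X →ᵇ ℂ),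
      (∀ x, ∑' i, ‖φ i x‖ₑ ^ p.toReal ≤ 1) →
      (∀ x y, dist x y ≤ R → ∑' i, ‖φ i x - φ i y‖ₑ ^ p.toReal ≤ δ) →
      ∀ η, ∑' i, ‖lpMul X E p (φ i) (a η) - a (lpMul X E p (φ i) η)‖ₑ ^ p.toReal ≤
        ε * ‖η‖ₑ ^ p.toReal := by
  have := hX.discreteTopology
  have hp1 := one_le_toReal_of_ne_top hp
  set P := p.toReal with hPdef
  have hP : 0 < P := by linarith
  set κ : ℝ≥0∞ := 2 ^ (P - 1) with hκ
  have hκt : κ ≠ ∞ := ENNReal.rpow_ne_top_of_nonneg (by linarith) (by simp)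
  have hε2 : ε / 2 ≠ 0 := by simpa using hε
  obtain ⟨r, hr, hrε⟩ := ENNReal.exists_nnreal_pos_mul_lt (a := κ * κ * 2) (by finiteness) hε2
  obtain ⟨c, hc, hac⟩ := mem_roeAlgebra_iff.1 ha ((r ^ (1 / P) : ℝ≥0) : ℝ)
    (by exact_mod_cast NNReal.rpow_pos hr)
  have hd : ‖a - c‖ₑ ^ P ≤ r := by
    have h1 : ‖a - c‖ₑ ≤ ((r ^ (1 / P) : ℝ≥0) : ℝ≥0∞) := by
      rw [enorm_eq_nnnorm]
      exact_mod_cast hac.le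
    refine (ENNReal.rpow_le_rpow h1 hP.le).trans (le_of_eq ?_)
    rw [ENNReal.coe_rpow_of_nonneg _ (by positivity), ← ENNReal.rpow_mul, one_div,
      inv_mul_cancel₀ hP.ne', ENNReal.rpow_one]
  obtain ⟨R, hR, hcR⟩ := (isEvaluation_lpEval p).exists_isLocal hc
  obtain ⟨N, hN⟩ := hX R
  obtain ⟨δ, hδ, hδε⟩ := ENNReal.exists_nnreal_pos_mul_lt (a := κ * (‖c‖ₑ ^ P * N))
    (by finiteness) hε2
  refine ⟨R, hR, δ, hδ, fun ι φ hφ hvar η => ?_⟩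
  set d := a - c with hd_def
  have hsplit : ∀ i, ‖lpMul X E p (φ i) (a η) - a (lpMul X E p (φ i) η)‖ₑ ^ P ≤
      κ * (‖lpMul X E p (φ i) (c η) - c (lpMul X E p (φ i) η)‖ₑ ^ P +
        κ * (‖lpMul X E p (φ i) (d η)‖ₑ ^ P + ‖d (lpMul X E p (φ i) η)‖ₑ ^ P)) := fun i => by
    have h1 : lpMul X E p (φ i) (a η) - a (lpMul X E p (φ i) η) =
        (lpMul X E p (φ i) (c η) - c (lpMul X E p (φ i) η)) +
          (lpMul X E p (φ i) (d η) - d (lpMul X E p (φ i) η)) := by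
      simp only [hd_def, sub_apply, map_sub]
      abel
    rw [h1]
    refine (ENNReal.rpow_le_rpow (enorm_add_le _ _) hP.le).trans
      ((ENNReal.rpow_add_le_mul_rpow_add_rpow _ _ hp1).trans ?_)
    gcongr κ * (_ + ?_)
    exact (ENNReal.rpow_le_rpow enorm_sub_le hP.le).trans
      (ENNReal.rpow_add_le_mul_rpow_add_rpow _ _ hp1)
  have h1 : ∑' i, ‖lpMul X E p (φ i) (d η)‖ₑ ^ P ≤ r * ‖η‖ₑ ^ P :=
    (tsum_lpMul_le hp φ hφ _).trans ((opENorm_rpow_le d η hP.le).trans (by gcongr))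
  have h2 : ∑' i, ‖d (lpMul X E p (φ i) η)‖ₑ ^ P ≤ r * ‖η‖ₑ ^ P := by
    calc _ ≤ ∑' i, r * ‖lpMul X E p (φ i) η‖ₑ ^ P :=
          ENNReal.tsum_le_tsum fun i => (opENorm_rpow_le d _ hP.le).trans (by gcongr)
      _ ≤ _ := by
        rw [ENNReal.tsum_mul_left]
        gcongr
        exact tsum_lpMul_le hp φ hφ η
  calc ∑' i, ‖lpMul X E p (φ i) (a η) - a (lpMul X E p (φ i) η)‖ₑ ^ P
      ≤ κ * (∑' i, ‖lpMul X E p (φ i) (c η) - c (lpMul X E p (φ i) η)‖ₑ ^ P +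
        κ * (∑' i, ‖lpMul X E p (φ i) (d η)‖ₑ ^ P +
          ∑' i, ‖d (lpMul X E p (φ i) η)‖ₑ ^ P)) := by
        refine (ENNReal.tsum_le_tsum hsplit).trans (le_of_eq ?_)
        rw [ENNReal.tsum_mul_left, ENNReal.tsum_add, ENNReal.tsum_mul_left, ENNReal.tsum_add]
    _ ≤ κ * (‖c‖ₑ ^ P * N * δ * ‖η‖ₑ ^ P + κ * (r * ‖η‖ₑ ^ P + r * ‖η‖ₑ ^ P)) := by
        gcongr
        exact tsum_commutator_le_of_isLocal hp hN hcR φ hvar η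
    _ = (δ * (κ * (‖c‖ₑ ^ P * N)) + r * (κ * κ * 2)) * ‖η‖ₑ ^ P := by ring
    _ ≤ (ε / 2 + ε / 2) * ‖η‖ₑ ^ P := by gcongr
    _ = ε * ‖η‖ₑ ^ P := by rw [ENNReal.add_halves]

/-- An inverse of an operator in the Roe algebra has the same property of almost commuting with
families of functions as the operators in the Roe algebra. -/
theorem tsum_commutator_inv_le (hX : BoundedGeometry X) (hp : p ≠ ∞)
    {a : (lp (fun _ : X => E) p →L[ℂ] lp (fun _ : X => E) p)ˣ} (ha : a.1 ∈ bandDominated X E p)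
    {ε : ℝ≥0} (hε : 0 < ε) :
    ∃ R : ℝ, 0 < R ∧ ∃ δ : ℝ≥0, 0 < δ ∧ ∀ (ι : Type u) (φ : ι → X →ᵇ ℂ),
      (∀ x, ∑' i, ‖φ i x‖ₑ ^ p.toReal ≤ 1) →
      (∀ x y, dist x y ≤ R → ∑' i, ‖φ i x - φ i y‖ₑ ^ p.toReal ≤ δ) →
      ∀ η, ∑' i, ‖lpMul X E p (φ i) (a⁻¹.1 η) - a⁻¹.1 (lpMul X E p (φ i) η)‖ₑ ^ p.toReal ≤
        (ε : ℝ≥0∞) ^ p.toReal * ‖η‖ₑ ^ p.toReal := by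
  have hP : 0 < p.toReal := one_pos.trans_le (one_le_toReal_of_ne_top hp)
  set P := p.toReal with hPdef
  obtain ⟨r, hr, hrε⟩ := ENNReal.exists_nnreal_pos_mul_lt
    (a := ‖a⁻¹.1‖ₑ ^ P * ‖a⁻¹.1‖ₑ ^ P) (b := (ε : ℝ≥0∞) ^ P) (by finiteness)
    (ENNReal.rpow_pos (by exact_mod_cast hε) (by simp)).ne'
  obtain ⟨R, hR, δ, hδ, h⟩ := tsum_commutator_le_of_mem_roeAlgebra hX hp ha
    (ε := r) (by exact_mod_cast hr.ne')
  refine ⟨R, hR, δ, hδ, fun ι φ hφ hvar η => ?_⟩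
  calc _ ≤ ∑' i, ‖a⁻¹.1‖ₑ ^ P * ‖lpMul X E p (φ i) (a.1 (a⁻¹.1 η)) -
        a.1 (lpMul X E p (φ i) (a⁻¹.1 η))‖ₑ ^ P := ENNReal.tsum_le_tsum fun i => by
        rw [commutator_inv_apply, enorm_neg]
        exact opENorm_rpow_le _ _ hP.le
    _ ≤ ‖a⁻¹.1‖ₑ ^ P * (r * (‖a⁻¹.1‖ₑ ^ P * ‖η‖ₑ ^ P)) := by
        rw [ENNReal.tsum_mul_left]
        gcongr
        exact (h ι φ hφ hvar _).trans (by gcongr; exact opENorm_rpow_le _ _ hP.le)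
    _ = r * (‖a⁻¹.1‖ₑ ^ P * ‖a⁻¹.1‖ₑ ^ P) * ‖η‖ₑ ^ P := by ring
    _ ≤ _ := by gcongr

end FiniteExponent

/-! ### The case `p = 1` -/

section ExponentOne

variable {X : Type u} [MetricSpace X] {E : Type v} [NormedAddCommGroup E] [NormedSpace ℂ E]

omit [MetricSpace X] in
open scoped Classical in
/-- A bounded family of operators on `ℓ^1` can be glued columnwise. -/
theorem exists_hasSum_single_one [CompleteSpace E] {C : ℝ} (hC : 0 ≤ C)
    (K : X → lp (fun _ : X => E) 1 →L[ℂ] lp (fun _ : X => E) 1)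
    (hK : ∀ y η, ‖K y η‖ ≤ C * ‖η‖) :
    ∃ S : lp (fun _ : X => E) 1 →L[ℂ] lp (fun _ : X => E) 1,
      ‖S‖ ≤ C ∧ ∀ ξ, HasSum (fun y => K y (lp.single 1 y (ξ y))) (S ξ) := by
  have hnorm : ∀ ξ : lp (fun _ : X => E) 1, HasSum (fun y => C * ‖ξ y‖) (C * ‖ξ‖) := fun ξ => by
    have h1 := lp.hasSum_norm (p := 1) (by simp) ξ
    simp only [ENNReal.toReal_one, Real.rpow_one] at h1
    exact h1.mul_left C
  have hle : ∀ (ξ : lp (fun _ : X => E) 1) y, ‖K y (lp.single 1 y (ξ y))‖ ≤ C * ‖ξ y‖ :=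
    fun ξ y => (hK y _).trans_eq (by rw [lp.norm_single one_pos])
  have hsum : ∀ ξ : lp (fun _ : X => E) 1, Summable fun y => K y (lp.single 1 y (ξ y)) := fun ξ =>
    Summable.of_norm_bounded (hnorm ξ).summable (hle ξ)
  let L : lp (fun _ : X => E) 1 →ₗ[ℂ] lp (fun _ : X => E) 1 :=
    { toFun := fun ξ => ∑' y, K y (lp.single 1 y (ξ y))
      map_add' := fun ξ η => by
        rw [← (hsum ξ).tsum_add (hsum η)]
        refine tsum_congr fun y => ?_
        rw [← map_add, ← lp.single_add]
        rfl
      map_smul' := fun c ξ => by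
        rw [RingHom.id_apply, ← (hsum ξ).tsum_const_smul]
        refine tsum_congr fun y => ?_
        rw [← map_smul, ← lp.single_smul]
        rfl }
  have hL : ∀ ξ, ‖L ξ‖ ≤ C * ‖ξ‖ := fun ξ => tsum_of_norm_bounded (hnorm ξ) (hle ξ)
  exact ⟨L.mkContinuous C hL, L.mkContinuous_norm_le hC hL, fun ξ => (hsum ξ).hasSum⟩

/-- On `ℓ^1`, the columns of the inverse are cut off by bump functions. -/
theorem closedUnderInverses_bandDominated_one [CompleteSpace E] (hX : BoundedGeometry X) :
    ClosedUnderInverses (bandDominated X E 1) := by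
  classical
  intro a ha
  refine mem_roeAlgebra_iff.2 fun ε hε => ?_
  have hε2 : 0 < (ε / 2).toNNReal := Real.toNNReal_pos.2 (half_pos hε)
  obtain ⟨R, hR, δ, hδ, hcomm⟩ := tsum_commutator_inv_le hX ENNReal.one_ne_top ha hε2
  simp only [ENNReal.toReal_one, ENNReal.rpow_one] at hcomm
  set a' := a⁻¹.1 with ha'
  have hS : 0 < R / δ := by positivity
  set f := bump (X := X) (R / δ) with hf
  obtain ⟨S, hS1, hS2⟩ := exists_hasSum_single_one (half_pos hε).le
    (fun y => lpMul X E 1 (f y) * a' - a' * lpMul X E 1 (f y)) fun y η => by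
      have h1 := hcomm PUnit (fun _ => f y)
        (fun x => by
          rw [tsum_fintype, Finset.univ_unique, Finset.sum_singleton, ← ofReal_norm,
            ENNReal.ofReal_le_one]
          exact ((f y).norm_coe_le_norm x).trans (norm_bump_le _ y))
        (fun x z hxz => by
          rw [tsum_fintype, Finset.univ_unique, Finset.sum_singleton, ← ofReal_norm]
          refine ENNReal.ofReal_le_of_le_toReal ((norm_bump_sub_le hS y x z).trans ?_)
          rw [ENNReal.coe_toReal, div_div_eq_mul_div, div_le_iff₀ hR, mul_comm]
          gcongr) η
      rw [tsum_fintype, Finset.univ_unique, Finset.sum_singleton] at h1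
      have h2 := ENNReal.toReal_mono (by finiteness) h1
      rwa [ENNReal.toReal_mul, toReal_enorm, toReal_enorm, ENNReal.coe_toReal,
        Real.coe_toNNReal _ (half_pos hε).le] at h2
  refine ⟨a' + S, IsLocal.mem_finitePropagation (isEvaluation_lpEval 1) (R := R / δ)
    fun x ξ hξ => ?_, ?_⟩
  -- Adding the commutators to `a'` leaves the columns `f y • a' (single y (ξ y))`.
  · have h1 := (((lp.hasSum_single ENNReal.one_ne_top ξ).mapL a').add (hS2 ξ)).mapL
      (lp.evalCLM ℂ (fun _ : X => E) 1 x)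
    refine h1.unique ?_
    convert hasSum_zero with y
    have h2 : a' (lp.single 1 y (ξ y)) + (lpMul X E 1 (f y) * a' - a' * lpMul X E 1 (f y))
        (lp.single 1 y (ξ y)) = lpMul X E 1 (f y) (a' (lp.single 1 y (ξ y))) := by
      have h3 : lpMul X E 1 (f y) (lp.single 1 y (ξ y)) = lp.single 1 y (ξ y) := by
        refine lp.ext (funext fun z => ?_)
        rw [lpMul_apply]
        rcases eq_or_ne z y with rfl | hz
        · rw [hf, bump_self, one_smul]
        · rw [lp.single_apply_ne _ _ _ hz, smul_zero]
      change _ + (lpMul X E 1 (f y) (a' (lp.single 1 y (ξ y))) -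
        a' (lpMul X E 1 (f y) (lp.single 1 y (ξ y)))) = _
      rw [h3, add_sub_cancel]
    rw [h2]
    change f y x • _ = (0 : E)
    rcases le_total (dist x y) (R / δ) with h | h
    · rw [show ξ y = 0 from hξ y h, lp.single_zero, map_zero, lp.coeFn_zero, Pi.zero_apply,
        smul_zero]
    · rw [hf, bump_eq_zero hS (by rwa [dist_comm]), zero_smul]
  · rw [sub_add_cancel_left, norm_neg]
    exact hS1.trans_lt (half_lt_self hε)

end ExponentOne

/-! ### Property A and partitions of unity with a prescribed exponent -/

/-- The power function with exponent `θ = q / p` changes `q`-variation into `p`-variation: by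
homogeneity, the estimate is continuity of `t ↦ t ^ θ` at `1` if `s` and `t` are comparable, and
it is trivial otherwise. -/
theorem exists_abs_rpow_sub_rpow_le {p q : ℝ} (hp : 1 ≤ p) (hq : 1 ≤ q) {δ : ℝ} (hδ : 0 < δ) :
    ∃ C : ℝ, 0 < C ∧ ∀ s t : ℝ, 0 ≤ s → 0 ≤ t →
      |s ^ (q / p) - t ^ (q / p)| ^ p ≤ δ * (s ^ q + t ^ q) + C * |s - t| ^ q := by
  have hp0 : 0 < p := by linarith
  have hq0 : 0 < q := by linarith
  have hθ : 0 < q / p := by positivity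
  have hcont : Filter.Tendsto (fun l : ℝ => |l ^ (q / p) - 1| ^ p) (nhds 1) (nhds 0) := by
    have h1 : ContinuousAt (fun l : ℝ => |l ^ (q / p) - 1| ^ p) 1 :=
      (((Real.continuousAt_rpow_const 1 _ (Or.inl one_ne_zero)).sub continuousAt_const).abs).rpow_const
        (Or.inr hp0.le)
    simpa [ContinuousAt, Real.zero_rpow hp0.ne'] using h1
  obtain ⟨κ, hκ, hball⟩ := Metric.eventually_nhds_iff.1 (hcont.eventually (gt_mem_nhds hδ))
  refine ⟨(κ ^ q)⁻¹, by positivity, ?_⟩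
  have key : ∀ s t : ℝ, 0 ≤ s → s ≤ t →
      |s ^ (q / p) - t ^ (q / p)| ^ p ≤ δ * (s ^ q + t ^ q) + (κ ^ q)⁻¹ * |s - t| ^ q := by
    intro s t hs hst
    rcases (hs.trans hst).eq_or_lt with ht | ht
    · have hs0 : s = 0 := by linarith
      subst hs0
      rw [← ht, sub_self, abs_zero, Real.zero_rpow hp0.ne']
      positivity
    set l := s / t with hl
    have hl0 : 0 ≤ l := by positivity
    have hl1 : l ≤ 1 := (div_le_one ht).2 hst
    have hs' : s = l * t := by rw [hl, div_mul_cancel₀ _ ht.ne']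
    have h1 : |s ^ (q / p) - t ^ (q / p)| ^ p = |l ^ (q / p) - 1| ^ p * t ^ q := by
      rw [hs', Real.mul_rpow hl0 ht.le, ← sub_one_mul, abs_mul,
        Real.mul_rpow (abs_nonneg _) (abs_nonneg _), abs_of_nonneg (Real.rpow_nonneg ht.le _),
        ← Real.rpow_mul ht.le, div_mul_cancel₀ _ hp0.ne']
    have h2 : |s - t| ^ q = (1 - l) ^ q * t ^ q := by
      rw [hs', ← sub_one_mul, abs_mul, Real.mul_rpow (abs_nonneg _) (abs_nonneg _), abs_of_pos ht,
        abs_sub_comm, abs_of_nonneg (sub_nonneg.2 hl1)]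
    have htq : 0 ≤ t ^ q := Real.rpow_nonneg ht.le q
    have hsq : 0 ≤ s ^ q := Real.rpow_nonneg hs q
    have h1l : 0 ≤ (1 - l) ^ q := Real.rpow_nonneg (sub_nonneg.2 hl1) q
    rw [h1, h2]
    rcases lt_or_ge (1 - l) κ with h | h
    · have h3 : |l ^ (q / p) - 1| ^ p < δ :=
        hball (by rwa [Real.dist_eq, abs_sub_comm, abs_of_nonneg (sub_nonneg.2 hl1)])
      have h4 : 0 ≤ (κ ^ q)⁻¹ * ((1 - l) ^ q * t ^ q) := by positivity
      nlinarith [mul_le_mul_of_nonneg_right h3.le htq, mul_nonneg hδ.le hsq]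
    · have h3 : |l ^ (q / p) - 1| ^ p ≤ 1 := by
        refine Real.rpow_le_one (abs_nonneg _) ?_ hp0.le
        rw [abs_sub_comm, abs_of_nonneg (sub_nonneg.2 (Real.rpow_le_one hl0 hl1 hθ.le))]
        exact sub_le_self _ (Real.rpow_nonneg hl0 _)
      have h4 : 1 ≤ (κ ^ q)⁻¹ * (1 - l) ^ q := by
        rw [inv_mul_eq_div, one_le_div (by positivity)]
        exact Real.rpow_le_rpow hκ.le h hq0.le
      have h5 : 0 ≤ δ * (s ^ q + t ^ q) := by positivity
      nlinarith [mul_le_mul_of_nonneg_right (h3.trans h4) htq]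
  intro s t hs ht
  rcases le_total s t with h | h
  · exact key s t hs h
  · rw [abs_sub_comm, abs_sub_comm s t, add_comm (s ^ q)]
    exact key t s ht h

theorem PropertyA.exists_partition {X : Type u} [MetricSpace X] (hA : PropertyA X) {p : ℝ}
    (hp : 1 ≤ p) (R : ℝ) (hR : 0 < R) {δ : ℝ≥0} (hδ : 0 < δ) :
    ∃ (ι : Type u) (ψ : ι → X → ℝ), (∀ i x, 0 ≤ ψ i x) ∧
      (∃ S : ℝ, ∀ i x y, ψ i x ≠ 0 → ψ i y ≠ 0 → dist x y ≤ S) ∧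
      (∀ x, {i | ψ i x ≠ 0}.Finite) ∧ (∀ x, ∑' i, ‖ψ i x‖ₑ ^ p = 1) ∧
      ∀ x y, dist x y ≤ R → ∑' i, ‖ψ i x - ψ i y‖ₑ ^ p ≤ δ := by
  obtain ⟨q, hq, hA⟩ := hA
  have hp0 : 0 < p := by linarith
  have hq0 : 0 < q := by linarith
  have hθ : 0 < q / p := by positivity
  have hδ' : (0 : ℝ) < δ := hδ
  obtain ⟨C, hC, hCle⟩ := exists_abs_rpow_sub_rpow_le hp hq (δ := δ / 4) (by positivity)
  obtain ⟨ι, φ, hφ, hvar⟩ := hA R hR ((δ / (2 * C)) ^ (1 / q)) (by positivity)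
  have h0 : ∀ i x, 0 ≤ φ i x := fun i x => (hφ.mem_Icc i x).1
  have hne : ∀ i x, φ i x ^ (q / p) ≠ 0 → x ∈ tsupport (φ i) := fun i x h =>
    subset_tsupport _ fun h' => h (by rw [h', Real.zero_rpow hθ.ne'])
  have hfin : ∀ x, {i | x ∈ tsupport (φ i)}.Finite := fun x => by
    obtain ⟨M, hM⟩ := hφ.finite_multiplicity
    exact Set.finite_of_encard_le_coe (hM x)
  have hpow : ∀ i x, (φ i x ^ (q / p)) ^ p = φ i x ^ q := fun i x => by
    rw [← Real.rpow_mul (h0 i x), div_mul_cancel₀ _ hp0.ne']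
  have henorm : ∀ r : ℝ, ‖r‖ₑ ^ p = ENNReal.ofReal (|r| ^ p) := fun r => by
    rw [← ofReal_norm, Real.norm_eq_abs, ENNReal.ofReal_rpow_of_nonneg (abs_nonneg _) hp0.le]
  refine ⟨ι, fun i x => φ i x ^ (q / p), fun i x => Real.rpow_nonneg (h0 i x) _, ?_, ?_, ?_, ?_⟩
  · obtain ⟨S, hS⟩ := hφ.uniformly_bounded
    exact ⟨S, fun i x y hx hy => hS i x (hne i x hx) y (hne i y hy)⟩
  · exact fun x => (hfin x).subset fun i hi => hne i x hi
  · intro x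
    have h1 := hφ.hasSum_one x
    simp_rw [henorm, abs_of_nonneg (Real.rpow_nonneg (h0 _ x) _), hpow]
    rw [← ENNReal.ofReal_tsum_of_nonneg (fun i => Real.rpow_nonneg (h0 i x) q) h1.summable,
      h1.tsum_eq, ENNReal.ofReal_one]
  · intro x y hxy
    -- Real sums are summable here because only finitely many terms are nonzero.
    have hs : Summable fun i => |φ i x - φ i y| ^ q := by
      refine summable_of_hasFiniteSupport (((hfin x).union (hfin y)).subset fun i hi => ?_)
      by_contra hxy'
      have hx0 : φ i x = 0 := by
        by_contra h
        exact hxy' (Or.inl (subset_tsupport _ h))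
      have hy0 : φ i y = 0 := by
        by_contra h
        exact hxy' (Or.inr (subset_tsupport _ h))
      exact hi (by simp [hx0, hy0, Real.zero_rpow hq0.ne'])
    have hv : ∑' i, |φ i x - φ i y| ^ q ≤ δ / (2 * C) := by
      have h2 := (hvar x y hxy).le
      rwa [← Real.rpow_mul (by positivity), one_div, inv_mul_cancel₀ hq0.ne', Real.rpow_one] at h2
    have hsum := (((hφ.hasSum_one x).add (hφ.hasSum_one y)).mul_left ((δ : ℝ) / 4)).add
      (hs.hasSum.mul_left C)
    simp_rw [henorm]
    calc ∑' i, ENNReal.ofReal (|φ i x ^ (q / p) - φ i y ^ (q / p)| ^ p)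
        ≤ ∑' i, ENNReal.ofReal (δ / 4 * (φ i x ^ q + φ i y ^ q) + C * |φ i x - φ i y| ^ q) :=
          ENNReal.tsum_le_tsum fun i => ENNReal.ofReal_le_ofReal (hCle _ _ (h0 i x) (h0 i y))
      _ = ENNReal.ofReal (δ / 4 * (1 + 1) + C * ∑' i, |φ i x - φ i y| ^ q) := by
          rw [← hsum.tsum_eq, ENNReal.ofReal_tsum_of_nonneg _ hsum.summable]
          intro i
          have := Real.rpow_nonneg (h0 i x) q
          have := Real.rpow_nonneg (h0 i y) q
          positivity
      _ ≤ ENNReal.ofReal δ := by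
          refine ENNReal.ofReal_le_ofReal ?_
          have h3 := mul_le_mul_of_nonneg_left hv hC.le
          have h4 : C * (δ / (2 * C)) = δ / 2 := by field_simp
          linarith
      _ = δ := ENNReal.ofReal_coe_nnreal

/-! ### The case `1 < p < ∞` -/

section PropertyA

variable {X : Type u} [MetricSpace X] {E : Type v} [NormedAddCommGroup E] [NormedSpace ℂ E]
  {p : ℝ≥0∞} [Fact (1 ≤ p)]

/-- Hölder's inequality for the weights `ψ i ^ (p - 1)` of a `p`-partition of unity. -/
theorem enorm_sum_rpow_smul_le {ι : Type*} {P : ℝ} (hP : 1 < P) (ψ : ι → ℝ) (hψ : ∀ i, 0 ≤ ψ i)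
    (hψ1 : ∑' i, ‖ψ i‖ₑ ^ P = 1) (s : Finset ι) (w : ι → E) :
    ‖∑ i ∈ s, ((ψ i ^ (P - 1) : ℝ) : ℂ) • w i‖ₑ ^ P ≤ ∑' i, ‖w i‖ₑ ^ P := by
  have hP0 : 0 < P := by linarith
  have hconj := (Real.HolderConjugate.conjExponent hP).symm
  set Q := P.conjExponent with hQ
  have h1 : ‖∑ i ∈ s, ((ψ i ^ (P - 1) : ℝ) : ℂ) • w i‖ₑ ≤
      ∑ i ∈ s, ‖ψ i‖ₑ ^ (P - 1) * ‖w i‖ₑ := by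
    refine (enorm_sum_le _ _).trans (Finset.sum_le_sum fun i _ => le_of_eq ?_)
    rw [enorm_smul]
    congr 1
    rw [← ofReal_norm, Complex.norm_real, Real.norm_of_nonneg (Real.rpow_nonneg (hψ i) _),
      ← ofReal_norm, Real.norm_of_nonneg (hψ i), ENNReal.ofReal_rpow_of_nonneg (hψ i) (by linarith)]
  have h2 : ∑ i ∈ s, (‖ψ i‖ₑ ^ (P - 1)) ^ Q ≤ 1 := by
    rw [← hψ1]
    refine le_trans (Finset.sum_le_sum fun i _ => le_of_eq ?_) (ENNReal.sum_le_tsum s)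
    rw [← ENNReal.rpow_mul, hQ, Real.conjExponent, mul_div_cancel₀ _ (by linarith)]
  have h3 := ENNReal.inner_le_Lp_mul_Lq s (fun i => ‖ψ i‖ₑ ^ (P - 1)) (fun i => ‖w i‖ₑ) hconj
  have h4 : ‖∑ i ∈ s, ((ψ i ^ (P - 1) : ℝ) : ℂ) • w i‖ₑ ≤ (∑ i ∈ s, ‖w i‖ₑ ^ P) ^ (1 / P) :=
    h1.trans (h3.trans (mul_le_of_le_one_left zero_le
      (ENNReal.rpow_le_one h2 (one_div_nonneg.2 hconj.nonneg))))
  refine (ENNReal.rpow_le_rpow h4 hP0.le).trans ?_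
  rw [← ENNReal.rpow_mul, one_div, inv_mul_cancel₀ hP0.ne', ENNReal.rpow_one]
  exact ENNReal.sum_le_tsum s

/-- With a `p`-partition of unity `ψ` of small variation, the inverse `a⁻¹` is approximated by the
operator `∑ i, ψ i ^ (p - 1) a⁻¹ ψ i` of finite propagation. -/
theorem closedUnderInverses_bandDominated_of_propertyA (hX : BoundedGeometry X)
    (hA : PropertyA X) (hp1 : 1 < p) (hp : p ≠ ∞) : ClosedUnderInverses (bandDominated X E p) := by
  have := hX.discreteTopology
  intro a ha
  refine mem_roeAlgebra_iff.2 fun ε hε => ?_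
  have hP1 : 1 < p.toReal := ENNReal.toReal_one ▸ (ENNReal.toReal_lt_toReal (by simp) hp).2 hp1
  set P := p.toReal with hPdef
  have hP0 : 0 < P := by linarith
  have hε2 : 0 < (ε / 2).toNNReal := Real.toNNReal_pos.2 (half_pos hε)
  obtain ⟨R, hR, δ, hδ, hcomm⟩ := tsum_commutator_inv_le hX hp ha hε2
  obtain ⟨ι, ψ, hψ, ⟨S, hS⟩, hfin, hsum, hvar⟩ := hA.exists_partition hP1.le R hR hδ
  set a' := a⁻¹.1 with ha'
  have henorm : ∀ r : ℝ, ‖(r : ℂ)‖ₑ = ‖r‖ₑ := fun r => by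
    rw [← ofReal_norm, Complex.norm_real, ofReal_norm]
  have hle1 : ∀ i x, ‖(ψ i x : ℂ)‖ ≤ 1 := fun i x => by
    have h1 : ‖ψ i x‖ₑ ^ P ≤ 1 := hsum x ▸ ENNReal.le_tsum i
    have h2 : ‖ψ i x‖ₑ ≤ 1 := by
      rwa [← ENNReal.rpow_le_rpow_iff hP0, ENNReal.one_rpow]
    rwa [← henorm, ← ofReal_norm, ENNReal.ofReal_le_one] at h2
  set φ : ι → X →ᵇ ℂ := fun i =>
    BoundedContinuousFunction.ofNormedAddCommGroupDiscrete (fun x => (ψ i x : ℂ)) 1 (hle1 i)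
  have hφ : ∀ i x, φ i x = (ψ i x : ℂ) := fun i x => rfl
  have hcomm' := hcomm ι φ (fun x => by simp_rw [hφ, henorm]; exact (hsum x).le)
    (fun x y hxy => by
      simp_rw [hφ, ← Complex.ofReal_sub, henorm]
      exact hvar x y hxy)
  set K : ι → lp (fun _ : X => E) p →L[ℂ] lp (fun _ : X => E) p := fun i =>
    lpMul X E p (φ i) * a' - a' * lpMul X E p (φ i) with hK
  obtain ⟨T, hT, hTapply⟩ := exists_lp_operator hp
    { toFun := fun ξ x => ∑ i ∈ (hfin x).toFinset, ((ψ i x ^ (P - 1) : ℝ) : ℂ) • K i ξ x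
      map_add' := fun ξ η => funext fun x => by
        simp only [map_add, lp.coeFn_add, Pi.add_apply, smul_add, Finset.sum_add_distrib]
      map_smul' := fun c ξ => funext fun x => by
        simp only [map_smul, lp.coeFn_smul, Pi.smul_apply, RingHom.id_apply, Finset.smul_sum]
        exact Finset.sum_congr rfl fun i _ => smul_comm _ _ _ } (ε / 2).toNNReal fun ξ => by
      refine le_trans (ENNReal.tsum_le_tsum (g := fun x => ∑' i, ‖K i ξ x‖ₑ ^ P) fun x => ?_)
        ((hcomm' ξ).trans_eq' ?_)
      · exact enorm_sum_rpow_smul_le hP1 (fun i => ψ i x) (fun i => hψ i x) (hsum x) _ _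
      · rw [ENNReal.tsum_comm]
        exact tsum_congr fun i => lp_enorm_rpow_eq_tsum hp (K i ξ)
  refine ⟨a' - T, IsLocal.mem_finitePropagation (isEvaluation_lpEval p) (R := S)
    fun x ξ hξ => ?_, ?_⟩
  · change a' ξ x - T ξ x = 0
    have hweights : ∑ i ∈ (hfin x).toFinset, ψ i x ^ P = 1 := by
      have h1 := hsum x
      rw [tsum_eq_sum (s := (hfin x).toFinset)] at h1
      · have h2 := congrArg ENNReal.toReal h1
        rw [ENNReal.toReal_sum (fun i _ => by finiteness), ENNReal.toReal_one] at h2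
        rw [← h2]
        refine Finset.sum_congr rfl fun i _ => ?_
        rw [← ENNReal.toReal_rpow, toReal_enorm, Real.norm_of_nonneg (hψ i x)]
      · intro i hi
        have h0 : ψ i x = 0 := by simpa using hi
        rw [h0, enorm_zero, ENNReal.zero_rpow_of_pos hP0]
    -- If `ψ i x ≠ 0`, then `ψ i` is supported where `ξ` vanishes, so that only the term
    -- `φ i (a' ξ)` of the commutator is left.
    have hterm : ∀ i ∈ (hfin x).toFinset, ((ψ i x ^ (P - 1) : ℝ) : ℂ) • K i ξ x =
        ((ψ i x ^ P : ℝ) : ℂ) • a' ξ x := fun i hi => by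
      have hne : ψ i x ≠ 0 := by simpa using hi
      have h0 : lpMul X E p (φ i) ξ = 0 := lp.ext (funext fun y => by
        rw [lpMul_apply, hφ]
        by_cases hy : ψ i y = 0
        · rw [hy, Complex.ofReal_zero, zero_smul]; rfl
        · rw [show ξ y = 0 from hξ y (hS i x y hne hy), smul_zero]; rfl)
      have h1 : K i ξ = lpMul X E p (φ i) (a' ξ) := by
        change lpMul X E p (φ i) (a' ξ) - a' (lpMul X E p (φ i) ξ) = _
        rw [h0, map_zero, sub_zero]
      rw [h1, lpMul_apply, hφ, smul_smul, ← Complex.ofReal_mul, ← Real.rpow_add_one hne,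
        sub_add_cancel]
    rw [hTapply]
    change a' ξ x - ∑ i ∈ (hfin x).toFinset, ((ψ i x ^ (P - 1) : ℝ) : ℂ) • K i ξ x = 0
    rw [Finset.sum_congr rfl hterm, ← Finset.sum_smul, ← Complex.ofReal_sum, hweights,
      Complex.ofReal_one, one_smul, sub_self]
  · rw [sub_sub_cancel]
    refine hT.trans_lt ?_
    rw [Real.coe_toNNReal _ (half_pos hε).le]
    exact half_lt_self hε

end PropertyA

/-! ### All exponents -/

theorem closedUnderInverses_bandDominated {X : Type u} [MetricSpace X] (hX : BoundedGeometry X)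
    (E : Type v) [NormedAddCommGroup E] [NormedSpace ℂ E] [CompleteSpace E] (p : ℝ≥0∞)
    [hp : Fact (1 ≤ p)] (hA : 1 < p → p < ∞ → PropertyA X) :
    ClosedUnderInverses (bandDominated X E p) := by
  have := hX.discreteTopology
  rcases hp.out.eq_or_lt with rfl | hp1
  · exact closedUnderInverses_bandDominated_one hX
  rcases eq_or_ne p ∞ with rfl | hpt
  · exact closedUnderInverses_bandDominated_top
  · exact closedUnderInverses_bandDominated_of_propertyA hX (hA hp1 hpt.lt_top) hp1 hpt

theorem corollary5p5 (X : Type u) [MetricSpace X] (hX : BoundedGeometry X)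
    (E : Type v) [NormedAddCommGroup E] [NormedSpace ℂ E] [CompleteSpace E] :
    (∀ (p : ℝ≥0∞) [Fact (1 ≤ p)], (1 < p → p < ∞ → PropertyA X) →
      ClosedUnderInverses (uniformRoe X p) ∧ ClosedUnderInverses (bandDominated X E p)) ∧
    (ClosedUnderInverses (uniformRoeZero X) ∧ ClosedUnderInverses (bandDominatedZero X E)) :=
  ⟨fun p _ hA => ⟨closedUnderInverses_bandDominated hX ℂ p hA,
    closedUnderInverses_bandDominated hX E p hA⟩,
    closedUnderInverses_bandDominatedZero hX, closedUnderInverses_bandDominatedZero hX⟩
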